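/- Lemma 3.1 (Characterization of a generalized Jacobi structure). Let $M$ be a smooth ($C^\infty$, Hausdorff, without boundary) manifold of dimension $n$, let $p\ge 1$ be an integer, let $\Lambda$ be a smooth $2p$-vector field and $E$ a smooth $(2p-1)$-vector field on $M$, regarded as alternating forms on covectors: $(X_1\wedge\dots\wedge X_k)(\alpha_1,\dots,\alpha_k)=\det(\alpha_i(X_j))$. For $f_1,\dots,f_{2p}\in C^\infty(M)$ put $$\{f_1,\dots,f_{2p}\}=\Lambda(df_1,\dots,df_{2p})-\sum_{j=1}^{2p}(-1)^j f_j\,E(df_1,\dots,\widehat{df_j},\dots,df_{2p}).$$ Then this bracket satisfies the generalized Jacobi identity $$\sum_{\sigma\in S_{4p-1}}\operatorname{sgn}(\sigma)\,\{f_{\sigma(1)},\dots,f_{\sigma(2p-1)},\{f_{\sigma(2p)},\dots,f_{\sigma(4p-1)}\}\}=0\qquad\text{for all } f_1,\dots,f_{4p-1}\in C^\infty(M)$$ if and only if $$[\Lambda,\Lambda]=2(2p-1)\,E\wedge\Lambda\quad\text{and}\quad[E,\Lambda]=0 .$$ Here $[\ ,\ ]$ is the Schouten–Nijenhuis bracket,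 with the sign convention $$[X_1\wedge\dots\wedge X_r,\,Y_1\wedge\dots\wedge Y_s]=\sum_{i,j}(-1)^{i+j}X_1\wedge\dots\widehat{X_i}\dots\wedge X_r\wedge[X_i,Y_j]\wedge Y_1\wedge\dots\widehat{Y_j}\dots\wedge Y_s ;$$ equivalently, in local coordinates, $[P,Q]=\sum_\nu\big(\iota_{dx^\nu}P\wedge\partial_\nu Q+(-1)^r\,\partial_\nu P\wedge\iota_{dx^\nu}Q\big)$ for an $r$-vector field $P$ and an $s$-vector field $Q$, where $\iota_\alpha P=P(\alpha,\dots)$ and $\partial_\nu$ differentiates components. -/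

import Mathlib

open scoped Manifold ContDiff

noncomputable section

/-- The covector (cotangent) space `T*_x M` of an `n`-manifold `M` at `x`. -/
abbrev Cotangent (n : ℕ) {M : Type*} [TopologicalSpace M]
    [ChartedSpace (EuclideanSpace ℝ (Fin n)) M] (x : M) : Type :=
  TangentSpace (𝓡 n) x →L[ℝ] ℝ

/-- The coordinate space `ℝⁿ`. -/
abbrev CoordSpace (n : ℕ) : Type := EuclideanSpace ℝ (Fin n)

/-- The dual `(ℝⁿ)*` of the coordinate space. -/
abbrev CoordDual (n : ℕ) : Type := CoordSpace n →L[ℝ] ℝ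

section PointwiseAlgebra

/-- The exterior product of alternating forms with the normalisation
`(P ∧ Q)(α₁, …, α_{a+b}) = ∑ sign(σ) P(α_{σ(1)}, …, α_{σ(a)}) Q(α_{σ(a+1)}, …, α_{σ(a+b)})`,
the sum being over the `(a, b)`-shuffles `σ`; thus `(X ∧ Y)(α, β) = α(X) β(Y) - α(Y) β(X)`. -/
def wedge {W : Type*} [AddCommGroup W] [Module ℝ W] {a b : ℕ}
    (P : W [⋀^Fin a]→ₗ[ℝ] ℝ) (Q : W [⋀^Fin b]→ₗ[ℝ] ℝ) : W [⋀^Fin (a + b)]→ₗ[ℝ] ℝ :=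
  ((LinearMap.mul' ℝ ℝ).compAlternatingMap (P.domCoprod Q)).domDomCongr finSumFinEquiv

/-- The coordinate covector `dx^ν` on `ℝⁿ`. -/
def coordCovector {n : ℕ} (ν : Fin n) : CoordDual n := EuclideanSpace.proj ν

/-- The coordinate vector `∂_ν` on `ℝⁿ`. -/
def coordVector {n : ℕ} (ν : Fin n) : CoordSpace n := EuclideanSpace.single ν 1

/-- The `ν`-th partial derivative `∂_ν P` at `y` of a multivector field `P` on `ℝⁿ` (the
components of `P` in the constant frame are differentiated). -/
def partialDeriv {n k : ℕ} (P : CoordSpace n → CoordDual n [⋀^Fin k]→L[ℝ] ℝ)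
    (ν : Fin n) (y : CoordSpace n) : CoordDual n [⋀^Fin k]→ₗ[ℝ] ℝ :=
  (fderiv ℝ P y (coordVector ν)).toAlternatingMap

/-- The contraction `ι(dx^ν) P = P(dx^ν, …)` at `y` of a multivector field `P` on `ℝⁿ`. -/
def contract {n k : ℕ} (P : CoordSpace n → CoordDual n [⋀^Fin (k + 1)]→L[ℝ] ℝ)
    (ν : Fin n) (y : CoordSpace n) : CoordDual n [⋀^Fin k]→ₗ[ℝ] ℝ :=
  (P y).toAlternatingMap.curryLeft (coordCovector ν)

/-- The Schouten–Nijenhuis bracket at `y` of an `(a+1)`-vector field `P` and a `(b+1)`-vector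
field `Q` on (an open subset of) `ℝⁿ`:
`[P, Q] = ∑_ν (ι(dx^ν) P ∧ ∂_ν Q + (-1)^(a+1) ∂_ν P ∧ ι(dx^ν) Q)`.
In components this is
`[P,Q]^K = 1/(a!(b+1)!) ε^K_{IJ} P^{νI} ∂_ν Q^J + (-1)^(a+1)/((a+1)!b!) ε^K_{IJ} Q^{νJ} ∂_ν P^I`,
i.e. the convention
`[X₁∧…∧X_r, Y₁∧…∧Y_s] = ∑ (-1)^(i+j) X₁∧…X̂_i…∧X_r ∧ [X_i, Y_j] ∧ Y₁∧…Ŷ_j…∧Y_s`. -/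
def coordSchouten {n a b : ℕ} (P : CoordSpace n → CoordDual n [⋀^Fin (a + 1)]→L[ℝ] ℝ)
    (Q : CoordSpace n → CoordDual n [⋀^Fin (b + 1)]→L[ℝ] ℝ) (y : CoordSpace n) :
    CoordDual n [⋀^Fin (a + b + 1)]→ₗ[ℝ] ℝ :=
  ∑ ν : Fin n,
    ((wedge (contract P ν y) (partialDeriv Q ν y)).domDomCongr (finCongr (by omega)) +
      (-1 : ℝ) ^ (a + 1) •
        (wedge (partialDeriv P ν y) (contract Q ν y)).domDomCongr (finCongr (by omega)))

end PointwiseAlgebra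

section Manifold

variable (n : ℕ) {M : Type*} [TopologicalSpace M] [ChartedSpace (EuclideanSpace ℝ (Fin n)) M]

/-- The pullback of covectors on `ℝⁿ` to covectors at `x` along the preferred chart at `x₀`:
`α ↦ α ∘ dφ_x`, where `φ` is the chart at `x₀`. -/
def chartPullback (x₀ x : M) : CoordDual n →L[ℝ] Cotangent n x :=
  ContinuousLinearMap.precomp ℝ
    (mfderiv (𝓡 n) 𝓘(ℝ, EuclideanSpace ℝ (Fin n)) (extChartAt (𝓡 n) x₀) x :
      TangentSpace (𝓡 n) x →L[ℝ] CoordSpace n)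

/-- The pushforward of covectors at `x` to covectors on `ℝⁿ` along the preferred chart `φ` at `x`:
`β ↦ β ∘ d(φ⁻¹)_{φ(x)}`. -/
def chartPushforward (x : M) : Cotangent n x →L[ℝ] CoordDual n :=
  ContinuousLinearMap.precomp ℝ
    (mfderiv 𝓘(ℝ, EuclideanSpace ℝ (Fin n)) (𝓡 n) (extChartAt (𝓡 n) x).symm (extChartAt (𝓡 n) x x) :
      CoordSpace n →L[ℝ] TangentSpace (𝓡 n) x)

/-- The local expression on `ℝⁿ` of a field of alternating `k`-forms on the cotangent spaces, in
the preferred chart `φ` at `x₀`:  its value on the coordinate covectors `dx^{i₁}, …, dx^{i_k}` at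
the point `y` is the component `P^{i₁ … i_k}` at `φ⁻¹(y)`. -/
def coordRep {k : ℕ} (P : ∀ x : M, Cotangent n x [⋀^Fin k]→L[ℝ] ℝ) (x₀ : M)
    (y : CoordSpace n) : CoordDual n [⋀^Fin k]→L[ℝ] ℝ :=
  (P ((extChartAt (𝓡 n) x₀).symm y)).compContinuousLinearMap
    (chartPullback n x₀ ((extChartAt (𝓡 n) x₀).symm y))

variable (M) in
/-- A smooth `k`-vector field on the `n`-manifold `M`: a field of alternating `k`-linear forms on
the cotangent spaces (equivalently, of elements of `⋀^k T_x M`) whose components in local charts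
are smooth. -/
structure MultivectorField (k : ℕ) where
  /-- the value at a point, as an alternating form on covectors -/
  toFun : ∀ x : M, Cotangent n x [⋀^Fin k]→L[ℝ] ℝ
  smooth : ∀ x₀ : M, ContDiffOn ℝ ∞ (coordRep n toFun x₀) (extChartAt (𝓡 n) x₀).target

variable {n}

/-- The exterior product `P ∧ Q` of two multivector fields, at `x`. -/
def MultivectorField.wedge {a b : ℕ} (P : MultivectorField n M a) (Q : MultivectorField n M b)
    (x : M) : Cotangent n x [⋀^Fin (a + b)]→ₗ[ℝ] ℝ :=
  _root_.wedge (P.toFun x).toAlternatingMap (Q.toFun x).toAlternatingMap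

/-- The Schouten–Nijenhuis bracket `[P, Q]` of an `(a+1)`-vector field and a `(b+1)`-vector field,
at `x`: it is computed in the chart at `x` and transported back to `x`. -/
def MultivectorField.schouten {a b : ℕ} (P : MultivectorField n M (a + 1))
    (Q : MultivectorField n M (b + 1)) (x : M) : Cotangent n x [⋀^Fin (a + b + 1)]→ₗ[ℝ] ℝ :=
  (coordSchouten (coordRep n P.toFun x) (coordRep n Q.toFun x) (extChartAt (𝓡 n) x x)).compLinearMap
    (chartPushforward n x).toLinearMap

/-- The differential `df` at `x` of a function on `M`. -/
def differential (f : M → ℝ) (x : M) : Cotangent n x :=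
  (mfderiv (𝓡 n) 𝓘(ℝ, ℝ) f x : TangentSpace (𝓡 n) x →L[ℝ] ℝ)

theorem contDiffOn_comp_extChartAt_symm [IsManifold (𝓡 n) ∞ M] {f : M → ℝ}
    (hf : ContMDiff (𝓡 n) 𝓘(ℝ, ℝ) ∞ f) (x₀ : M) :
    ContDiffOn ℝ ∞ (f ∘ (extChartAt (𝓡 n) x₀).symm) (extChartAt (𝓡 n) x₀).target :=
  (hf.comp_contMDiffOn (contMDiffOn_extChartAt_symm x₀)).contDiffOn

theorem chartPullback_differential [IsManifold (𝓡 n) ∞ M] {f : M → ℝ}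
    (hf : ContMDiff (𝓡 n) 𝓘(ℝ, ℝ) ∞ f) (x₀ : M) {x : M} (hx : x ∈ (extChartAt (𝓡 n) x₀).source) :
    chartPullback n x₀ x
      (fderiv ℝ (f ∘ (extChartAt (𝓡 n) x₀).symm) (extChartAt (𝓡 n) x₀ x)) =
      differential f x := by
  have hy : extChartAt (𝓡 n) x₀ x ∈ (extChartAt (𝓡 n) x₀).target :=
    (extChartAt (𝓡 n) x₀).map_source hx
  have h1 : DifferentiableAt ℝ (f ∘ (extChartAt (𝓡 n) x₀).symm) (extChartAt (𝓡 n) x₀ x) :=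
    ((contDiffOn_comp_extChartAt_symm hf x₀).differentiableOn (by simp)).differentiableAt
      ((isOpen_extChartAt_target x₀).mem_nhds hy)
  have h2 : MDifferentiableAt (𝓡 n) 𝓘(ℝ, CoordSpace n) (extChartAt (𝓡 n) x₀) x :=
    mdifferentiableAt_extChartAt (by simpa using hx)
  have h3 : f =ᶠ[nhds x] (f ∘ (extChartAt (𝓡 n) x₀).symm) ∘ (extChartAt (𝓡 n) x₀) := by
    filter_upwards [(isOpen_extChartAt_source (I := 𝓡 n) x₀).mem_nhds hx] with z hz
    exact (congrArg f ((extChartAt (𝓡 n) x₀).left_inv hz)).symm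
  unfold differential
  rw [h3.mfderiv_eq, mfderiv_comp x h1.mdifferentiableAt h2, mfderiv_eq_fderiv]
  rfl

theorem contMDiff_apply_differential [IsManifold (𝓡 n) ∞ M] {k : ℕ} (P : MultivectorField n M k)
    (f : Fin k → M → ℝ) (hf : ∀ i, ContMDiff (𝓡 n) 𝓘(ℝ, ℝ) ∞ (f i)) :
    ContMDiff (𝓡 n) 𝓘(ℝ, ℝ) ∞ (fun x => P.toFun x (fun i => differential (f i) x)) := by
  intro x₀
  let φ := extChartAt (𝓡 n) x₀
  let g : CoordSpace n → ℝ := fun y =>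
    coordRep n P.toFun x₀ y (fun i => fderiv ℝ (f i ∘ φ.symm) y)
  have hg : ContDiffOn ℝ ∞ g φ.target := by
    have hd : ContDiffOn ℝ ∞ (fun y => fun i => fderiv ℝ (f i ∘ φ.symm) y) φ.target :=
      contDiffOn_pi.2 fun i => (contDiffOn_comp_extChartAt_symm (hf i) x₀).fderiv_of_isOpen
        (isOpen_extChartAt_target x₀) (by simp)
    have hu : ContDiff ℝ ∞ (fun q : (CoordDual n [⋀^Fin k]→L[ℝ] ℝ) × (Fin k → CoordDual n) =>
        q.1 q.2) :=
      contDiff_iff_contDiffAt.2 fun q =>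
        ((ContinuousAlternatingMap.toContinuousMultilinearMapLI (𝕜 := ℝ) (E := CoordDual n)
          (F := ℝ) (ι := Fin k)).toContinuousLinearMap.analyticAt_uncurry_of_multilinear
            (x := q)).contDiffAt
    exact hu.comp_contDiffOn ((P.smooth x₀).prodMk hd)
  have hfg : (fun x => P.toFun x (fun i => differential (f i) x)) =ᶠ[nhds x₀] g ∘ φ := by
    filter_upwards [(isOpen_extChartAt_source (I := 𝓡 n) x₀).mem_nhds
      (mem_extChartAt_source (I := 𝓡 n) x₀)] with z hz
    have key : ∀ w : M, w = z → P.toFun z (fun i => differential (f i) z) =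
        P.toFun w (fun i => chartPullback n x₀ w (fderiv ℝ (f i ∘ φ.symm) (φ z))) := by
      rintro w rfl
      congr 1
      funext i
      exact (chartPullback_differential (hf i) x₀ hz).symm
    exact key _ (φ.left_inv hz)
  refine ContMDiffAt.congr_of_eventuallyEq ?_ hfg
  have hgat : ContMDiffAt 𝓘(ℝ, CoordSpace n) 𝓘(ℝ, ℝ) ∞ g (φ x₀) :=
    (hg.contDiffAt ((isOpen_extChartAt_target x₀).mem_nhds
      (mem_extChartAt_target (I := 𝓡 n) x₀))).contMDiffAt
  exact hgat.comp x₀ contMDiffAt_extChartAt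

/-- The bracket of `k + 1` functions defined by a `(k+1)`-vector field `Λ` and a `k`-vector field
`E`: `{f₁, …, f_{k+1}} = Λ(df₁, …, df_{k+1}) - ∑_j (-1)^j f_j E(df₁, …, omit df_j, …, df_{k+1})`.
The index `j : Fin (k + 1)` starts at `0`, hence the exponent `j + 1`. -/
def genJacobiBracket [IsManifold (𝓡 n) ∞ M] {k : ℕ} (Λ : MultivectorField n M (k + 1))
    (E : MultivectorField n M k) (f : Fin (k + 1) → C^∞⟮𝓡 n, M; 𝓘(ℝ, ℝ), ℝ⟯) :
    C^∞⟮𝓡 n, M; 𝓘(ℝ, ℝ), ℝ⟯ where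
  val x := Λ.toFun x (fun i => differential (f i) x) -
    ∑ j : Fin (k + 1), (-1 : ℝ) ^ ((j : ℕ) + 1) * f j x *
      E.toFun x (fun i => differential (f (j.succAbove i)) x)
  property := by
    refine (contMDiff_apply_differential Λ _ fun i => (f i).contMDiff).sub
      (contMDiff_finsetSum fun j _ => ((contMDiff_const).mul (f j).contMDiff).mul
        (contMDiff_apply_differential E _ fun i => (f (j.succAbove i)).contMDiff))

/-- The generalized Jacobi identity for a bracket of `k + 1` functions: for all smooth functions
`f₁, …, f_{2k+1}`,
`∑_σ sign(σ) {f_{σ(1)}, …, f_{σ(k)}, {f_{σ(k+1)}, …, f_{σ(2k+1)}}} = 0`. -/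
def GenJacobiIdentity {k : ℕ}
    (br : (Fin (k + 1) → C^∞⟮𝓡 n, M; 𝓘(ℝ, ℝ), ℝ⟯) → C^∞⟮𝓡 n, M; 𝓘(ℝ, ℝ), ℝ⟯) : Prop :=
  ∀ f : Fin (k + (k + 1)) → C^∞⟮𝓡 n, M; 𝓘(ℝ, ℝ), ℝ⟯,
    ∑ σ : Equiv.Perm (Fin (k + (k + 1))), ((Equiv.Perm.sign σ : ℤ) : ℝ) •
      br (Fin.snoc (α := fun _ => C^∞⟮𝓡 n, M; 𝓘(ℝ, ℝ), ℝ⟯)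
        (fun i : Fin k => f (σ (Fin.castAdd (k + 1) i)))
        (br (fun i : Fin (k + 1) => f (σ (Fin.natAdd k i))))) = 0

end Manifold

end

/-!
At each point the bracket is an alternating `(k+1)`-form `D` on the `1`-jets `(f, df)`, with
`k = 2p - 1`: `D = Λ + t ∧ E`, where `t` reads off the value `f`. In a chart, the jet of an inner
bracket involves the first derivatives of `D` and the Hessians of its arguments. Since Hessians are
symmetric and `k` is odd, exchanging the two groups of `k` functions shows that the Hessian terms
drop out of the alternating sum, and what remains is `k! (k+1)!` times
`J = k ι_e D ∧ D - ∑_ν ι_{dx^ν} D ∧ ∂_ν D`, a form on `1`-jets, with `e = (1, 0)` the jet of the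
constant function `1`. Every `1`-jet at a point is the jet of a global smooth function, so the
generalized Jacobi identity says that `J` vanishes everywhere. An alternating form on `ℝ × T*`
vanishes if and only if it and its contraction with `e` both vanish on `T*`: for `J` itself this is
`[Λ, Λ] = 2 (2p - 1) E ∧ Λ`, and for `ι_e J` it is `[E, Λ] = 0`.
-/

section AlternatingSums

open Equiv Fin

theorem sum_sign_smul_mul_right {α A : Type*} [Fintype α] [DecidableEq α] [AddCommGroup A]
    (F : Perm α → A) (τ : Perm α) :
    ∑ σ, Perm.sign σ • F (σ * τ) = Perm.sign τ • ∑ σ, Perm.sign σ • F σ := by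
  rw [← Equiv.sum_comp (Equiv.mulRight τ) fun σ => Perm.sign σ • F σ, Finset.smul_sum]
  refine Finset.sum_congr rfl fun σ _ => ?_
  rw [coe_mulRight, Perm.sign_mul, smul_smul, mul_left_comm, Int.units_mul_self, mul_one]

theorem sum_sign_smul_cons {W A : Type*} [AddCommGroup A] {N : ℕ} (F : (Fin (N + 1) → W) → A)
    (u : W) (w : Fin N → W) :
    ∑ σ : Perm (Fin (N + 1)), Perm.sign σ • F (cons (α := fun _ => W) u w ∘ σ) =
      ∑ p : Fin (N + 1), (-1 : ℤˣ) ^ (p : ℕ) •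
        ∑ τ : Perm (Fin N), Perm.sign τ • F (p.insertNth u (w ∘ τ)) := by
  let g : Fin (N + 1) × Perm (Fin N) → Perm (Fin (N + 1)) := fun q =>
    Perm.decomposeFin.symm (0, q.2) * cycleRange q.1
  have g_self (p τ) : g (p, τ) p = 0 := by simp [g]
  have g_succAbove (p τ i) : g (p, τ) (p.succAbove i) = (τ i).succ := by simp [g]
  have sign_g (p τ) : Perm.sign (g (p, τ)) = (-1) ^ (p : ℕ) * Perm.sign τ := by
    simp [g, sign_cycleRange, Perm.decomposeFin.symm_sign, mul_comm]
  have cons_comp_g (p τ) : cons (α := fun _ => W) u w ∘ g (p, τ) = p.insertNth u (w ∘ τ) :=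
    eq_insertNth_iff.2 ⟨by simp [g_self], funext fun i => by simp [removeNth, g_succAbove]⟩
  have g_bijective : Function.Bijective g := by
    refine (Fintype.bijective_iff_injective_and_card g).2 ⟨?_, by
      simp [Fintype.card_perm, Nat.factorial_succ]⟩
    rintro ⟨p, τ⟩ ⟨p', τ'⟩ h
    obtain rfl : p = p' := (g (p, τ)).injective (by rw [g_self, h, g_self])
    congr 1
    ext1 i
    exact Fin.succ_injective _ (by rw [← g_succAbove p, ← g_succAbove p, h])
  rw [← g_bijective.sum_comp, Fintype.sum_prod_type]
  simp_rw [sign_g, cons_comp_g, mul_smul, Finset.smul_sum]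

theorem insertNth_comp_eq_comp {W ι : Type*} {N : ℕ} {p : Fin (N + 1)} {f : ι → Fin (N + 1)}
    {g : ι → Fin N} (h : ∀ j, f j = p.succAbove (g j)) (u : W) (x : Fin N → W) :
    (p.insertNth u x : Fin (N + 1) → W) ∘ f = x ∘ g := by
  funext j
  rw [Function.comp_apply, h, insertNth_apply_succAbove, Function.comp_apply]

theorem insertNth_comp_eq_insertNth {W : Type*} {M N : ℕ} {p : Fin (N + 1)} {q : Fin (M + 1)}
    {f : Fin (M + 1) → Fin (N + 1)} {g : Fin M → Fin N} (hp : f q = p)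
    (h : ∀ j, f (q.succAbove j) = p.succAbove (g j)) (u : W) (x : Fin N → W) :
    (p.insertNth u x : Fin (N + 1) → W) ∘ f = q.insertNth u (x ∘ g) := by
  refine eq_insertNth_iff.2 ⟨by simp [hp], funext fun j => ?_⟩
  rw [removeNth, Function.comp_apply, h, insertNth_apply_succAbove, Function.comp_apply]

section Blocks

variable {W : Type*} {a b : ℕ}

theorem insertNth_castAdd_comp_castAdd (i : Fin (a + 1)) (u : W) (x : Fin (a + 1 + b) → W) :
    (insertNth (castAdd (b + 1) i : Fin (a + 1 + b + 1)) u x : Fin (a + 1 + b + 1) → W) ∘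
      castAdd (b + 1) =
        (i.insertNth u (x ∘ Fin.cast (by omega) ∘ castAdd (b + 1)) : Fin (a + 1) → W) := by
  refine insertNth_comp_eq_insertNth rfl (fun j => ?_) u x
  grind [Fin.succAbove]

theorem insertNth_castAdd_comp_natAdd (i : Fin (a + 1)) (u : W) (x : Fin (a + 1 + b) → W) :
    (insertNth (castAdd (b + 1) i : Fin (a + 1 + b + 1)) u x : Fin (a + 1 + b + 1) → W) ∘
      natAdd (a + 1) = x ∘ Fin.cast (by omega) ∘ natAdd (m := b + 1) a := by
  refine insertNth_comp_eq_comp (fun j => ?_) u x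
  grind [Fin.succAbove]

theorem insertNth_natAdd_comp_castAdd (i : Fin (b + 1)) (u : W) (x : Fin (a + b) → W) :
    (insertNth (natAdd a i : Fin (a + b + 1)) u x : Fin (a + b + 1) → W) ∘ castAdd (b + 1) =
      x ∘ castAdd b := by
  refine insertNth_comp_eq_comp (fun j => ?_) u x
  grind [Fin.succAbove]

theorem insertNth_natAdd_comp_natAdd (i : Fin (b + 1)) (u : W) (x : Fin (a + b) → W) :
    (insertNth (natAdd a i : Fin (a + b + 1)) u x : Fin (a + b + 1) → W) ∘ natAdd a =
      (i.insertNth u (x ∘ natAdd a) : Fin (b + 1) → W) := by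
  refine insertNth_comp_eq_insertNth rfl (fun j => ?_) u x
  rcases lt_or_ge j.castSucc i with h | h
  · rw [succAbove_of_castSucc_lt _ _ h, succAbove_of_castSucc_lt _ _ (by simpa using h)]
    rfl
  · rw [succAbove_of_le_castSucc _ _ h, succAbove_of_le_castSucc _ _ (by simpa using h)]
    rfl

end Blocks

end AlternatingSums

section Wedge

open Equiv Fin
open scoped Nat

variable {W : Type*} [AddCommGroup W] [Module ℝ W] {a b : ℕ}

theorem factorial_nsmul_wedge_apply (P : W [⋀^Fin a]→ₗ[ℝ] ℝ) (Q : W [⋀^Fin b]→ₗ[ℝ] ℝ)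
    (v : Fin (a + b) → W) :
    (a ! * b !) • wedge P Q v = ∑ σ : Perm (Fin (a + b)),
      Perm.sign σ • (P (v ∘ σ ∘ castAdd b) * Q (v ∘ σ ∘ natAdd a)) := by
  have h := congrArg (fun f => LinearMap.mul' ℝ ℝ (f (v ∘ finSumFinEquiv)))
    (MultilinearMap.domCoprod_alternization_eq P Q)
  simp only [Fintype.card_fin, MultilinearMap.alternatization_apply, AlternatingMap.smul_apply,
    map_sum, map_nsmul] at h
  refine h.symm.trans ?_
  rw [← (permCongr (finSumFinEquiv (m := a) (n := b))).sum_comp]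
  refine Finset.sum_congr rfl fun σ _ => ?_
  rw [Units.smul_def, Units.smul_def, map_zsmul, Perm.sign_permCongr]
  simp [permCongr_apply, Function.comp_def]

theorem wedge_compLinearMap {V : Type*} [AddCommGroup V] [Module ℝ V]
    (P : W [⋀^Fin a]→ₗ[ℝ] ℝ) (Q : W [⋀^Fin b]→ₗ[ℝ] ℝ) (f : V →ₗ[ℝ] W) :
    (wedge P Q).compLinearMap f = wedge (P.compLinearMap f) (Q.compLinearMap f) := by
  ext v
  refine nsmul_right_injective (mul_ne_zero a.factorial_ne_zero b.factorial_ne_zero) ?_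
  simp only [AlternatingMap.compLinearMap_apply, factorial_nsmul_wedge_apply]
  rfl

theorem smul_wedge (r : ℝ) (P : W [⋀^Fin a]→ₗ[ℝ] ℝ) (Q : W [⋀^Fin b]→ₗ[ℝ] ℝ) :
    wedge (r • P) Q = r • wedge P Q := by
  ext v
  refine nsmul_right_injective (mul_ne_zero a.factorial_ne_zero b.factorial_ne_zero) ?_
  simp only [AlternatingMap.smul_apply, smul_comm _ r, factorial_nsmul_wedge_apply,
    Finset.smul_sum, smul_mul_assoc]

theorem zero_wedge (Q : W [⋀^Fin b]→ₗ[ℝ] ℝ) : wedge (0 : W [⋀^Fin a]→ₗ[ℝ] ℝ) Q = 0 := by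
  simpa only [zero_smul] using smul_wedge 0 (0 : W [⋀^Fin a]→ₗ[ℝ] ℝ) Q

theorem neg_wedge (P : W [⋀^Fin a]→ₗ[ℝ] ℝ) (Q : W [⋀^Fin b]→ₗ[ℝ] ℝ) :
    wedge (-P) Q = -wedge P Q := by
  ext v
  refine nsmul_right_injective (mul_ne_zero a.factorial_ne_zero b.factorial_ne_zero) ?_
  simp only [AlternatingMap.neg_apply, smul_neg, factorial_nsmul_wedge_apply,
    ← Finset.sum_neg_distrib, neg_mul]

theorem val_finRotate_pow (N j : ℕ) (i : Fin N) : ((finRotate N ^ j) i : ℕ) = (i + j) % N := by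
  cases N with
  | zero => exact i.elim0
  | succ N =>
    induction j with
    | zero => simp [Nat.mod_eq_of_lt i.2]
    | succ j ih =>
      rw [pow_succ', Perm.mul_apply, finRotate_apply, val_add, ih, val_one', ← Nat.add_mod,
        add_assoc]

theorem sign_finAddFlip_trans_finCongr (a b : ℕ) :
    Perm.sign ((finAddFlip (m := a) (n := b)).trans (finCongr (add_comm b a))) =
      (-1) ^ (a * b) := by
  have flip_eq : (finAddFlip (m := a) (n := b)).trans (finCongr (add_comm b a)) =
      finRotate (a + b) ^ b := by
    ext i
    rw [val_finRotate_pow]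
    cases i using addCases with
    | left i => simp [Nat.mod_eq_of_lt (show (i : ℕ) + b < a + b by omega)]
    | right i => simp [add_right_comm a i b, Nat.mod_eq_of_lt (show (i : ℕ) < a + b by omega)]
  rw [flip_eq, map_pow, sign_finRotate, ← pow_mul]
  cases b with
  | zero => simp
  | succ b =>
    rw [← add_assoc, Nat.add_sub_cancel, add_mul, pow_add,
      (Nat.even_mul_succ_self b).neg_one_pow, mul_one]

theorem wedge_comm (P : W [⋀^Fin a]→ₗ[ℝ] ℝ) (Q : W [⋀^Fin b]→ₗ[ℝ] ℝ) :
    (wedge P Q).domDomCongr (finCongr (add_comm a b)) = (-1 : ℝ) ^ (a * b) • wedge Q P := by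
  ext v
  refine nsmul_right_injective (mul_ne_zero a.factorial_ne_zero b.factorial_ne_zero) ?_
  simp only [AlternatingMap.domDomCongr_apply, AlternatingMap.smul_apply,
    smul_comm _ ((-1 : ℝ) ^ (a * b))]
  rw [factorial_nsmul_wedge_apply, mul_comm a !, factorial_nsmul_wedge_apply,
    ← (equivCongr finAddFlip.symm (finCongr (add_comm b a))).sum_comp, Finset.smul_sum]
  refine Finset.sum_congr rfl fun σ _ => ?_
  rw [Perm.sign_equivCongr, symm_symm, sign_finAddFlip_trans_finCongr]
  simp only [equivCongr, Function.comp_def, finCongr_apply, finCongr_symm, symm_symm, coe_fn_mk,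
    coe_trans, finAddFlip_apply_castAdd, finAddFlip_apply_natAdd, Fin.cast_cast, cast_eq_self,
    Units.smul_def, Units.val_mul, Units.val_pow_eq_pow_val, Units.val_neg, Units.val_one,
    zsmul_eq_mul, Int.cast_mul, Int.cast_pow, Int.cast_neg, Int.cast_one, smul_eq_mul]
  ring

theorem wedge_self_of_odd (ha : Odd a) (P : W [⋀^Fin a]→ₗ[ℝ] ℝ) : wedge P P = 0 := by
  have h : wedge P P = (-1 : ℝ) ^ (a * a) • wedge P P := wedge_comm P P
  rw [(ha.mul ha).neg_one_pow] at h
  ext v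
  simpa [self_eq_neg] using DFunLike.congr_fun h v

theorem curryLeft_swap {R V N : Type*} [CommRing R] [AddCommGroup V] [Module R V]
    [AddCommGroup N] [Module R N] (P : V [⋀^Fin (a + 2)]→ₗ[R] N) (u w : V) :
    (P.curryLeft u).curryLeft w = -(P.curryLeft w).curryLeft u := by
  have h := P.curryLeft_same (u + w)
  simp only [map_add, AlternatingMap.curryLeft_add, LinearMap.add_apply,
    AlternatingMap.curryLeft_same, zero_add, add_zero] at h
  exact eq_neg_of_add_eq_zero_right h

theorem neg_one_pow_smul_map_insertNth {R V N : Type*} [CommRing R] [AddCommGroup V] [Module R V]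
    [AddCommGroup N] [Module R N] (P : V [⋀^Fin (a + 1)]→ₗ[R] N) (i : Fin (a + 1)) (u : V)
    (x : Fin a → V) : (-1 : ℤˣ) ^ (i : ℕ) • P (i.insertNth u x) = P.curryLeft u x := by
  simpa [Units.smul_def] using P.neg_one_pow_smul_map_insertNth i u x

theorem curryLeft_wedge (P : W [⋀^Fin (a + 1)]→ₗ[ℝ] ℝ) (Q : W [⋀^Fin (b + 1)]→ₗ[ℝ] ℝ) (u : W) :
    AlternatingMap.curryLeft (n := a + 1 + b) (wedge P Q) u =
      (wedge (P.curryLeft u) Q).domDomCongr (finCongr (by omega)) +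
        (-1 : ℝ) ^ (a + 1) • wedge P (Q.curryLeft u) := by
  ext w
  refine nsmul_right_injective
    (mul_ne_zero (a + 1).factorial_ne_zero (b + 1).factorial_ne_zero) ?_
  have left_block (i : Fin (a + 1)) : (-1 : ℤˣ) ^ (i : ℕ) • ∑ τ : Perm (Fin (a + 1 + b)),
      Perm.sign τ • (P (i.insertNth u ((w ∘ τ) ∘ Fin.cast (by omega) ∘ castAdd (b + 1))) *
        Q ((w ∘ τ) ∘ Fin.cast (by omega) ∘ natAdd a)) =
      (a ! * (b + 1)!) • (wedge (P.curryLeft u) Q).domDomCongr (finCongr (by omega)) w := by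
    rw [AlternatingMap.domDomCongr_apply, factorial_nsmul_wedge_apply,
      ← (permCongr (finCongr (by omega : a + 1 + b = a + (b + 1)))).sum_comp, Finset.smul_sum]
    refine Finset.sum_congr rfl fun τ _ => ?_
    rw [smul_comm, ← smul_mul_assoc, neg_one_pow_smul_map_insertNth, Perm.sign_permCongr]
    rfl
  have right_block (i : Fin (b + 1)) : (-1 : ℤˣ) ^ (i : ℕ) • ∑ τ : Perm (Fin (a + 1 + b)),
      Perm.sign τ • (P ((w ∘ τ) ∘ castAdd b) * Q (i.insertNth u ((w ∘ τ) ∘ natAdd (a + 1)))) =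
      ((a + 1)! * b !) • wedge P (Q.curryLeft u) w := by
    rw [factorial_nsmul_wedge_apply, Finset.smul_sum]
    refine Finset.sum_congr rfl fun τ _ => ?_
    rw [smul_comm, ← mul_smul_comm, neg_one_pow_smul_map_insertNth]
    rfl
  simp only [AlternatingMap.curryLeft_apply_apply]
  rw [factorial_nsmul_wedge_apply]
  refine (sum_sign_smul_cons (fun v : Fin (a + 1 + b + 1) → W =>
    P (v ∘ castAdd (b + 1)) * Q (v ∘ natAdd (a + 1))) u w).trans ?_
  refine (Fin.sum_univ_add (a := a + 1) (b := b + 1) _).trans ?_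
  simp only [insertNth_castAdd_comp_castAdd, insertNth_castAdd_comp_natAdd,
    insertNth_natAdd_comp_castAdd, insertNth_natAdd_comp_natAdd, val_castAdd, val_natAdd,
    pow_add _ (a + 1), mul_smul, left_block, right_block, Finset.sum_const, Finset.card_univ,
    Fintype.card_fin, AlternatingMap.add_apply, AlternatingMap.smul_apply]
  simp only [Nat.factorial_succ, nsmul_eq_mul, Nat.cast_mul, Units.smul_def,
    Units.val_pow_eq_pow_val, Units.val_neg, Units.val_one, zsmul_eq_mul, Int.cast_pow,
    Int.cast_neg, Int.cast_one, smul_eq_mul, smul_add]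
  ring

end Wedge

section OuterBlockSwap

open Equiv Fin

/-- The involution of `Fin (k + (k + 1))` exchanging the two outer blocks of length `k` and fixing
the middle index `natAdd k 0`. -/
def outerBlockSwap (k : ℕ) : Perm (Fin (k + (k + 1))) :=
  Function.Involutive.toPerm
    (addCases (fun i => natAdd k i.succ) (cases (natAdd k 0) (castAdd (k + 1))))
    fun i => by
      cases i using addCases with
      | left i => simp
      | right i => cases i using cases <;> simp

theorem outerBlockSwap_apply {k : ℕ} (i : Fin (k + (k + 1))) :
    outerBlockSwap k i =
      addCases (fun i => natAdd k i.succ) (cases (natAdd k 0) (castAdd (k + 1))) i := rfl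

theorem outerBlockSwap_castAdd {k : ℕ} (i : Fin k) :
    outerBlockSwap k (castAdd (k + 1) i) = natAdd k i.succ := by
  simp [outerBlockSwap_apply]

theorem outerBlockSwap_natAdd_zero (k : ℕ) : outerBlockSwap k (natAdd k 0) = natAdd k 0 := by
  simp [outerBlockSwap_apply]

theorem outerBlockSwap_natAdd_succ {k : ℕ} (i : Fin k) :
    outerBlockSwap k (natAdd k i.succ) = castAdd (k + 1) i := by
  simp [outerBlockSwap_apply]

theorem outerBlockSwap_eq_self_iff {k : ℕ} {i : Fin (k + (k + 1))} :
    outerBlockSwap k i = i ↔ i = natAdd k 0 := by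
  refine ⟨fun h => ?_, fun h => h ▸ outerBlockSwap_natAdd_zero k⟩
  cases i using addCases with
  | left i =>
    have := congrArg Fin.val h
    simp only [outerBlockSwap_castAdd, val_natAdd, val_succ, val_castAdd] at this
    omega
  | right i =>
    cases i using cases with
    | zero => rfl
    | succ i =>
      have := congrArg Fin.val h
      simp only [outerBlockSwap_natAdd_succ, val_castAdd, val_natAdd, val_succ] at this
      omega

theorem sign_outerBlockSwap (k : ℕ) : Perm.sign (outerBlockSwap k) = (-1) ^ k := by
  have sq : outerBlockSwap k ^ 2 = 1 := by
    ext1 i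
    exact Function.Involutive.toPerm_involutive _ i
  have card_fixed : Fintype.card (Function.fixedPoints (outerBlockSwap k)) = 1 :=
    Fintype.card_eq_one_iff.2 ⟨⟨natAdd k 0, outerBlockSwap_natAdd_zero k⟩,
      fun i => Subtype.ext (outerBlockSwap_eq_self_iff.1 i.2)⟩
  rw [Perm.sign_of_pow_two_eq_one sq, card_fixed, Fintype.card_fin]
  congr 1
  omega

variable {A : Type*} [AddCommGroup A] {k : ℕ}

theorem sum_sign_smul_outerBlockSwap
    (F : Fin (k + (k + 1)) → (Fin k → Fin (k + (k + 1))) → (Fin k → Fin (k + (k + 1))) → A) :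
    ∑ σ : Perm (Fin (k + (k + 1))), Perm.sign σ •
        F (σ (natAdd k 0)) (σ ∘ natAdd k ∘ succ) (σ ∘ castAdd (k + 1)) =
      (-1 : ℤˣ) ^ k • ∑ σ : Perm (Fin (k + (k + 1))), Perm.sign σ •
        F (σ (natAdd k 0)) (σ ∘ castAdd (k + 1)) (σ ∘ natAdd k ∘ succ) := by
  rw [← sign_outerBlockSwap, ← sum_sign_smul_mul_right]
  simp only [Perm.mul_apply, outerBlockSwap_natAdd_zero, Perm.coe_mul, Function.comp_def,
    outerBlockSwap_castAdd, outerBlockSwap_natAdd_succ]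

theorem sum_sign_smul_eq_zero_of_symm [IsAddTorsionFree A] (hk : Odd k)
    {F : Fin (k + (k + 1)) → (Fin k → Fin (k + (k + 1))) → (Fin k → Fin (k + (k + 1))) → A}
    (hF : ∀ i x y, F i x y = F i y x) :
    ∑ σ : Perm (Fin (k + (k + 1))), Perm.sign σ •
      F (σ (natAdd k 0)) (σ ∘ castAdd (k + 1)) (σ ∘ natAdd k ∘ succ) = 0 := by
  have h := sum_sign_smul_outerBlockSwap F
  simp only [hF _ (_ ∘ _ ∘ succ), hk.neg_one_pow, Units.neg_smul, one_smul] at h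
  exact self_eq_neg.1 h

end OuterBlockSwap

section AlternatingMaps

variable {R V V' N ι κ : Type*} [CommSemiring R] [AddCommMonoid V] [Module R V]
  [AddCommMonoid V'] [Module R V'] [AddCommMonoid N] [Module R N]

theorem alternatingMap_sum_apply (s : Finset κ) (f : κ → V [⋀^ι]→ₗ[R] N) (v : ι → V) :
    (∑ j ∈ s, f j) v = ∑ j ∈ s, f j v :=
  map_sum (⟨⟨fun F => F v, rfl⟩, fun _ _ => rfl⟩ : V [⋀^ι]→ₗ[R] N →+ N) f s

theorem sum_compLinearMap (s : Finset κ)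
    (f : κ → V [⋀^ι]→ₗ[R] N) (g : V' →ₗ[R] V) :
    (∑ j ∈ s, f j).compLinearMap g = ∑ j ∈ s, (f j).compLinearMap g :=
  map_sum (⟨⟨(·.compLinearMap g), AlternatingMap.zero_compLinearMap g⟩, fun _ _ =>
    AlternatingMap.add_compLinearMap ..⟩ : V [⋀^ι]→ₗ[R] N →+ V' [⋀^ι]→ₗ[R] N) f s

theorem compLinearMap_eq_smul_iff {f : V' →ₗ[R] V} (hf : Function.Surjective f)
    (P Q : V [⋀^ι]→ₗ[R] N) (c : R) :
    P.compLinearMap f = c • Q.compLinearMap f ↔ P = c • Q :=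
  AlternatingMap.compLinearMap_inj f hf P (c • Q)

end AlternatingMaps

section Jacobiator

open Equiv Fin
open scoped Nat

variable {U : Type*} [AddCommGroup U] [Module ℝ U] {k : ℕ}

/-- The functional `u ↦ D (u, x₁, …, x_k)`. -/
def contractDual (D : U [⋀^Fin (k + 1)]→ₗ[ℝ] ℝ) (x : Fin k → U) : Module.Dual ℝ U where
  toFun u := D.curryLeft u x
  map_add' u w := by rw [map_add, AlternatingMap.add_apply]
  map_smul' r u := by rw [map_smul, AlternatingMap.smul_apply, RingHom.id_apply]

theorem contractDual_apply (D : U [⋀^Fin (k + 1)]→ₗ[ℝ] ℝ) (x : Fin k → U) (u : U) :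
    contractDual D x u = D.curryLeft u x := rfl

theorem map_snoc_eq_contractDual (D : U [⋀^Fin (k + 1)]→ₗ[ℝ] ℝ) (x : Fin k → U) (u : U) :
    D (snoc (α := fun _ => U) x u) = (-1 : ℝ) ^ k * contractDual D x u := by
  have h := neg_one_pow_smul_map_insertNth D (last k) u x
  rw [insertNth_last', val_last, Units.smul_def] at h
  rw [contractDual_apply, ← h, zsmul_eq_mul, ← mul_assoc]
  simp [← mul_pow]

/-- The obstruction to the generalized Jacobi identity at a point: the bracket is given by the
alternating form `D` on `1`-jets, whose derivatives in the coordinate directions are `D' ν`; `e` is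
the jet of the constant `1` and `dx ν` the jet of the `ν`-th coordinate (centred at the point). -/
def jacobiator {ι : Type*} [Fintype ι] (D : U [⋀^Fin (k + 1)]→ₗ[ℝ] ℝ)
    (D' : ι → U [⋀^Fin (k + 1)]→ₗ[ℝ] ℝ) (e : U) (dx : ι → U) :
    U [⋀^Fin (k + (k + 1))]→ₗ[ℝ] ℝ :=
  (k : ℝ) • wedge (D.curryLeft e) D - ∑ ν, wedge (D.curryLeft (dx ν)) (D' ν)

theorem jacobiator_apply {ι : Type*} [Fintype ι] (D : U [⋀^Fin (k + 1)]→ₗ[ℝ] ℝ)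
    (D' : ι → U [⋀^Fin (k + 1)]→ₗ[ℝ] ℝ) (e : U) (dx : ι → U) (v : Fin (k + (k + 1)) → U) :
    jacobiator D D' e dx v =
      k * wedge (D.curryLeft e) D v - ∑ ν, wedge (D.curryLeft (dx ν)) (D' ν) v := by
  rw [jacobiator, AlternatingMap.sub_apply, AlternatingMap.smul_apply, alternatingMap_sum_apply,
    smul_eq_mul]

theorem compLinearMap_jacobiator {ι V : Type*} [Fintype ι] [AddCommGroup V] [Module ℝ V]
    (D : U [⋀^Fin (k + 1)]→ₗ[ℝ] ℝ) (D' : ι → U [⋀^Fin (k + 1)]→ₗ[ℝ] ℝ) (e : U) (dx : ι → U)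
    (f : V →ₗ[ℝ] U) :
    (jacobiator D D' e dx).compLinearMap f =
      (k : ℝ) • wedge ((D.curryLeft e).compLinearMap f) (D.compLinearMap f) -
        ∑ ν, wedge ((D.curryLeft (dx ν)).compLinearMap f) ((D' ν).compLinearMap f) := by
  simp only [← wedge_compLinearMap, ← sum_compLinearMap]
  rfl

theorem cons_comp_natAdd {α : Type*} {a b : ℕ} (x : Fin (a + (b + 1)) → α) :
    cons (α := fun _ => α) (x (natAdd a 0)) (x ∘ natAdd a ∘ succ) = x ∘ natAdd a :=
  cons_self_tail (α := fun _ => α) (x ∘ natAdd a)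

theorem sum_sign_smul_mul_update {a b : ℕ} (P : U [⋀^Fin a]→ₗ[ℝ] ℝ)
    (D : U [⋀^Fin (b + 1)]→ₗ[ℝ] ℝ) (v g : Fin (a + (b + 1)) → U) (i : Fin (b + 1)) :
    ∑ σ : Perm (Fin (a + (b + 1))), Perm.sign σ • (P (v ∘ σ ∘ castAdd (b + 1)) *
        D (Function.update (v ∘ σ ∘ natAdd a) i (g (σ (natAdd a i))))) =
      ∑ σ : Perm (Fin (a + (b + 1))), Perm.sign σ • (P (v ∘ σ ∘ castAdd (b + 1)) *
        contractDual D (v ∘ σ ∘ natAdd a ∘ succ) (g (σ (natAdd a 0)))) := by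
  let τ : Perm (Fin (a + (b + 1))) := swap (natAdd a 0) (natAdd a i)
  have sign_τ : Perm.sign τ = Perm.sign (swap 0 i) := by
    simp [τ, Perm.sign_swap', (natAdd_injective (b + 1) a).eq_iff]
  have τ_castAdd (j : Fin a) : τ (castAdd (b + 1) j) = castAdd (b + 1) j :=
    swap_apply_of_ne_of_ne (by simp [Fin.ext_iff]; omega) (by simp [Fin.ext_iff]; omega)
  have τ_natAdd (j : Fin (b + 1)) : τ (natAdd a j) = natAdd a (swap 0 i j) :=
    ((natAdd_injective (b + 1) a).map_swap 0 i j).symm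
  have update_eq (σ : Perm (Fin (a + (b + 1)))) :
      Function.update (v ∘ (σ * τ) ∘ natAdd a) i (g ((σ * τ) (natAdd a i))) =
        cons (α := fun _ => U) (g (σ (natAdd a 0))) (v ∘ σ ∘ natAdd a ∘ succ) ∘ swap 0 i := by
    have h : v ∘ (σ * τ) ∘ natAdd a =
        cons (α := fun _ => U) (v (σ (natAdd a 0))) (v ∘ σ ∘ natAdd a ∘ succ) ∘ swap 0 i := by
      refine .trans ?_ (congrArg (· ∘ _) (cons_comp_natAdd (v ∘ σ)).symm)
      exact funext fun j => congrArg (v ∘ σ) (τ_natAdd j)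
    rw [h, Perm.mul_apply, τ_natAdd, swap_apply_right]
    refine .trans ?_ (congrArg (· ∘ swap 0 i)
      (update_cons_zero (α := fun _ => U) (v (σ (natAdd a 0))) _ _))
    rw [Function.update_comp_equiv, symm_swap, swap_apply_left]
  have comp_castAdd (σ : Perm (Fin (a + (b + 1)))) :
      v ∘ (σ * τ) ∘ castAdd (b + 1) = v ∘ σ ∘ castAdd (b + 1) :=
    funext fun j => congrArg (v ∘ σ) (τ_castAdd j)
  refine smul_left_cancel (Perm.sign τ) ?_
  rw [← sum_sign_smul_mul_right, Finset.smul_sum]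
  refine Finset.sum_congr rfl fun σ _ => ?_
  rw [update_eq, comp_castAdd, D.map_perm, mul_smul_comm, smul_comm, sign_τ]
  rfl

theorem sum_sign_smul_contractDual_mul (P : U [⋀^Fin k]→ₗ[ℝ] ℝ) (D : U [⋀^Fin (k + 1)]→ₗ[ℝ] ℝ)
    (v : Fin (k + (k + 1)) → U) :
    ∑ σ : Perm (Fin (k + (k + 1))), Perm.sign σ •
        (contractDual D (v ∘ σ ∘ castAdd (k + 1)) (v (σ (natAdd k 0))) *
          P (v ∘ σ ∘ natAdd k ∘ succ)) =
      (-1 : ℤˣ) ^ k • (k ! * (k + 1)!) • wedge P D v := by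
  refine (sum_sign_smul_outerBlockSwap fun i x y => contractDual D (v ∘ y) (v i) * P (v ∘ x)).trans
    (congrArg _ ?_)
  rw [factorial_nsmul_wedge_apply]
  refine Finset.sum_congr rfl fun σ _ => ?_
  rw [mul_comm]
  exact congrArg (fun x => _ • (_ * D x)) (cons_comp_natAdd (v ∘ σ))

variable {ι : Type*} [Fintype ι]

-- For `v i` the `1`-jet of `fᵢ` and `g ν i` its derivative along `∂_ν`, the terms of `hg` with a
-- first derivative of `fᵢ` cancel, and those left are symmetric because the Hessian of `fᵢ` is.
theorem sum_sign_smul_contact (hk : Odd k) (D : U [⋀^Fin (k + 1)]→ₗ[ℝ] ℝ) (e : U) (dx : ι → U)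
    (v : Fin (k + (k + 1)) → U) (g : ι → Fin (k + (k + 1)) → U)
    (hg : ∀ i (α β : Module.Dual ℝ U), ∑ ν, α (dx ν) * β (g ν i) - α (v i) * β e =
      ∑ ν, β (dx ν) * α (g ν i) - β (v i) * α e) :
    ∑ σ : Perm (Fin (k + (k + 1))), Perm.sign σ • ∑ ν,
      contractDual D (v ∘ σ ∘ castAdd (k + 1)) (dx ν) *
        contractDual D (v ∘ σ ∘ natAdd k ∘ succ) (g ν (σ (natAdd k 0))) =
      -((k ! * (k + 1)!) • wedge (D.curryLeft e) D v) := by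
  have symm_part := sum_sign_smul_eq_zero_of_symm hk fun i x y =>
    hg i (contractDual D (v ∘ x)) (contractDual D (v ∘ y))
  simp only [smul_sub, Finset.sum_sub_distrib, sub_eq_zero] at symm_part
  refine symm_part.trans ((sum_sign_smul_contractDual_mul (D.curryLeft e) D v).trans ?_)
  rw [hk.neg_one_pow, Units.neg_smul, one_smul]

theorem map_snoc_jet (hk : Odd k) (D : U [⋀^Fin (k + 1)]→ₗ[ℝ] ℝ) (x : Fin k → U) (e : U)
    (dx : ι → U) (b : ℝ) (c : ι → ℝ) :
    D (snoc (α := fun _ => U) x (b • e + ∑ ν, c ν • dx ν)) =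
      -(D.curryLeft e x * b + ∑ ν, contractDual D x (dx ν) * c ν) := by
  simp only [map_snoc_eq_contractDual, hk.neg_one_pow, map_add, map_sum, map_smul, smul_eq_mul,
    neg_one_mul, contractDual_apply, mul_comm]

theorem sum_sign_smul_argument_terms (hk : Odd k) (D : U [⋀^Fin (k + 1)]→ₗ[ℝ] ℝ) (e : U)
    (dx : ι → U) (v : Fin (k + (k + 1)) → U) (g : ι → Fin (k + (k + 1)) → U)
    (hg : ∀ i (α β : Module.Dual ℝ U), ∑ ν, α (dx ν) * β (g ν i) - α (v i) * β e =
      ∑ ν, β (dx ν) * α (g ν i) - β (v i) * α e) :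
    ∑ σ : Perm (Fin (k + (k + 1))), Perm.sign σ • ∑ ν,
      contractDual D (v ∘ σ ∘ castAdd (k + 1)) (dx ν) *
        ∑ i, D (Function.update (v ∘ σ ∘ natAdd k) i (g ν (σ (natAdd k i)))) =
      -((k + 1) • (k ! * (k + 1)!) • wedge (D.curryLeft e) D v) := by
  calc
    _ = ∑ ν, ∑ i, ∑ σ : Perm (Fin (k + (k + 1))), Perm.sign σ •
        (D.curryLeft (dx ν) (v ∘ σ ∘ castAdd (k + 1)) *
          D (Function.update (v ∘ σ ∘ natAdd k) i (g ν (σ (natAdd k i))))) := by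
      simp only [Finset.mul_sum, Finset.smul_sum, contractDual_apply]
      exact Finset.sum_comm.trans (Finset.sum_congr rfl fun ν _ => Finset.sum_comm)
    _ = (k + 1) • ∑ ν, ∑ σ : Perm (Fin (k + (k + 1))), Perm.sign σ •
        (D.curryLeft (dx ν) (v ∘ σ ∘ castAdd (k + 1)) *
          contractDual D (v ∘ σ ∘ natAdd k ∘ succ) (g ν (σ (natAdd k 0)))) := by
      simp only [sum_sign_smul_mul_update, Finset.sum_const, Finset.card_univ, Fintype.card_fin,
        Finset.smul_sum]
    _ = -((k + 1) • (k ! * (k + 1)!) • wedge (D.curryLeft e) D v) := by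
      rw [← smul_neg, ← sum_sign_smul_contact hk D e dx v g hg, Finset.sum_comm]
      simp only [Finset.smul_sum, contractDual_apply]

theorem sum_sign_smul_iterate (hk : Odd k) (D : U [⋀^Fin (k + 1)]→ₗ[ℝ] ℝ)
    (D' : ι → U [⋀^Fin (k + 1)]→ₗ[ℝ] ℝ) (e : U) (dx : ι → U) (v : Fin (k + (k + 1)) → U)
    (g : ι → Fin (k + (k + 1)) → U)
    (hg : ∀ i (α β : Module.Dual ℝ U), ∑ ν, α (dx ν) * β (g ν i) - α (v i) * β e =
      ∑ ν, β (dx ν) * α (g ν i) - β (v i) * α e) :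
    ∑ σ : Perm (Fin (k + (k + 1))), Perm.sign σ •
      D (snoc (α := fun _ => U) (v ∘ σ ∘ castAdd (k + 1))
        (D (v ∘ σ ∘ natAdd k) • e + ∑ ν, (D' ν (v ∘ σ ∘ natAdd k) + ∑ i,
          D (Function.update (v ∘ σ ∘ natAdd k) i (g ν (σ (natAdd k i))))) • dx ν)) =
      (k ! * (k + 1)!) • jacobiator D D' e dx v := by
  have derivative_terms : ∑ σ : Perm (Fin (k + (k + 1))), Perm.sign σ • ∑ ν,
      contractDual D (v ∘ σ ∘ castAdd (k + 1)) (dx ν) * D' ν (v ∘ σ ∘ natAdd k) =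
      (k ! * (k + 1)!) • ∑ ν, wedge (D.curryLeft (dx ν)) (D' ν) v := by
    simp only [Finset.smul_sum, factorial_nsmul_wedge_apply, contractDual_apply]
    exact Finset.sum_comm
  simp only [map_snoc_jet hk, mul_add, Finset.sum_add_distrib, neg_add, smul_add, smul_neg,
    Finset.sum_neg_distrib, sum_sign_smul_argument_terms hk D e dx v g hg,
    derivative_terms, ← factorial_nsmul_wedge_apply, jacobiator_apply, nsmul_eq_mul]
  push_cast
  ring

end Jacobiator

section ProductForms

variable {R V N : Type*} [CommRing R] [AddCommGroup V] [Module R V] [AddCommGroup N] [Module R N]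

theorem eq_zero_of_compLinearMap_inr_eq_zero {ι : Type*} [Finite ι]
    {η : (R × V) [⋀^ι]→ₗ[R] N} (h_inr : η.compLinearMap (LinearMap.inr R R V) = 0)
    (h_one : ∀ v i, v i = (1, 0) → η v = 0) : η = 0 := by
  classical
  cases nonempty_fintype ι
  ext v
  have split : v = (fun i => (v i).1 • ((1, 0) : R × V)) + fun i => (0, (v i).2) := by
    ext i <;> simp
  rw [split]
  refine (η.toMultilinearMap.map_add_univ _ _).trans (Finset.sum_eq_zero fun s _ => ?_)
  rcases s.eq_empty_or_nonempty with rfl | ⟨i, hi⟩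
  · rw [Finset.piecewise_empty]
    exact DFunLike.congr_fun h_inr fun i => (v i).2
  · rw [← Function.update_eq_self i (s.piecewise _ _), Finset.piecewise_eq_of_mem _ _ _ hi,
      MultilinearMap.map_update_smul, AlternatingMap.coe_multilinearMap,
      h_one _ i (Function.update_self ..), smul_zero]

theorem eq_zero_iff_inr_and_curryLeft_inr {k : ℕ} (η : (R × V) [⋀^Fin (k + 1)]→ₗ[R] N) :
    η = 0 ↔ η.compLinearMap (LinearMap.inr R R V) = 0 ∧
      (η.curryLeft (1, 0)).compLinearMap (LinearMap.inr R R V) = 0 := by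
  refine ⟨fun h => by subst h; exact ⟨rfl, rfl⟩, fun ⟨h_inr, h_curry⟩ => ?_⟩
  have curry_eq : η.curryLeft (1, 0) = 0 :=
    eq_zero_of_compLinearMap_inr_eq_zero h_curry fun v i hv =>
      η.map_eq_zero_of_eq (i := 0) (j := i.succ) _ (by simpa using hv.symm)
        (Fin.succ_ne_zero i).symm
  refine eq_zero_of_compLinearMap_inr_eq_zero h_inr fun v i hv => ?_
  refine smul_left_cancel ((-1 : ℤˣ) ^ (i : ℕ)) ?_
  rw [← Fin.insertNth_self_removeNth i v, hv, neg_one_pow_smul_map_insertNth, curry_eq,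
    smul_zero, AlternatingMap.zero_apply]

theorem curryLeft_jacobiator_self {U ι : Type*} [AddCommGroup U] [Module ℝ U] [Fintype ι] {m : ℕ}
    (hm : Odd (m + 1)) (D : U [⋀^Fin (m + 1 + 1)]→ₗ[ℝ] ℝ)
    (D' : ι → U [⋀^Fin (m + 1 + 1)]→ₗ[ℝ] ℝ) (e : U) (dx : ι → U) :
    (jacobiator D D' e dx).curryLeft (n := m + 1 + (m + 1)) e =
      ∑ ν, ((wedge ((D.curryLeft e).curryLeft (dx ν)) (D' ν)).domDomCongr (finCongr (by omega)) +
        wedge (D.curryLeft (dx ν)) ((D' ν).curryLeft e)) := by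
  ext w
  let v : Fin (m + 1 + (m + 1 + 1)) → U := Fin.cons (α := fun _ => U) e w
  have curry_first : wedge (D.curryLeft e) D v = 0 := by
    refine (DFunLike.congr_fun (curryLeft_wedge (D.curryLeft e) D e) w).trans ?_
    rw [AlternatingMap.curryLeft_same, zero_wedge, wedge_self_of_odd hm, smul_zero, add_zero]
    rfl
  have curry_term (ν : ι) : wedge (D.curryLeft (dx ν)) (D' ν) v =
      -((wedge ((D.curryLeft e).curryLeft (dx ν)) (D' ν)).domDomCongr (finCongr (by omega)) w +
        wedge (D.curryLeft (dx ν)) ((D' ν).curryLeft e) w) := by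
    refine (DFunLike.congr_fun (curryLeft_wedge (D.curryLeft (dx ν)) (D' ν) e) w).trans ?_
    rw [curryLeft_swap, neg_wedge, hm.neg_one_pow]
    simp [add_comm]
  refine (jacobiator_apply D D' e dx v).trans ?_
  simp only [curry_first, curry_term, alternatingMap_sum_apply, mul_zero, zero_sub,
    Finset.sum_neg_distrib, neg_neg, AlternatingMap.add_apply]

end ProductForms

section JetForm

variable {V : Type*} [NormedAddCommGroup V] [NormedSpace ℝ V] {k m : ℕ}

/-- The alternating form `Λ(α₀, …, α_k) + ∑_j (-1)^j f_j E(α₀, …, omit α_j, …, α_k)` on `1`-jets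
`(f_i, α_i) ∈ ℝ × V`, where `α_i` stands for `df_i`. Linear dependence on `(Λ, E)` is part of the
definition so that fields of jet forms can be differentiated by the chain rule. -/
noncomputable def jetForm (V : Type*) [NormedAddCommGroup V] [NormedSpace ℝ V] (k : ℕ) :
    (V [⋀^Fin (k + 1)]→L[ℝ] ℝ) × (V [⋀^Fin k]→L[ℝ] ℝ) →L[ℝ] (ℝ × V) [⋀^Fin (k + 1)]→L[ℝ] ℝ :=
  let onSnd (l : ℕ) : V [⋀^Fin l]→L[ℝ] ℝ →L[ℝ] (ℝ × V) [⋀^Fin l]→L[ℝ] ℝ :=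
    ContinuousAlternatingMap.compContinuousLinearMapCLM (ContinuousLinearMap.snd ℝ ℝ V)
  (onSnd (k + 1)).coprod ((ContinuousAlternatingMap.alternatizeUncurryFinCLM ℝ (ℝ × V) ℝ).comp
    ((ContinuousLinearMap.smulRightL ℝ (ℝ × V) _ (ContinuousLinearMap.fst ℝ ℝ V)).comp (onSnd k)))

theorem jetForm_apply (L : V [⋀^Fin (k + 1)]→L[ℝ] ℝ) (E : V [⋀^Fin k]→L[ℝ] ℝ)
    (v : Fin (k + 1) → ℝ × V) :
    jetForm V k (L, E) v = L (fun i => (v i).2) +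
      ∑ j : Fin (k + 1), (-1 : ℝ) ^ (j : ℕ) * ((v j).1 * E (fun i => (v (j.succAbove i)).2)) := by
  have wedge_term := ContinuousAlternatingMap.alternatizeUncurryFin_apply
    ((ContinuousLinearMap.fst ℝ ℝ V).smulRight
      (E.compContinuousLinearMap (ContinuousLinearMap.snd ℝ ℝ V))) v
  refine congrArg (L (fun i => (v i).2) + ·) (wedge_term.trans (Finset.sum_congr rfl fun j _ => ?_))
  rw [zsmul_eq_mul, Int.cast_pow, Int.cast_neg, Int.cast_one]
  rfl

theorem jetForm_compLinearMap_inr (L : V [⋀^Fin (k + 1)]→L[ℝ] ℝ) (E : V [⋀^Fin k]→L[ℝ] ℝ) :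
    (jetForm V k (L, E)).toAlternatingMap.compLinearMap (LinearMap.inr ℝ ℝ V) =
      L.toAlternatingMap := by
  ext β
  simpa using jetForm_apply L E fun i => (0, β i)

theorem curryLeft_jetForm_one (L : V [⋀^Fin (k + 1)]→L[ℝ] ℝ) (E : V [⋀^Fin k]→L[ℝ] ℝ) :
    (jetForm V k (L, E)).toAlternatingMap.curryLeft (1, 0) =
      E.toAlternatingMap.compLinearMap (LinearMap.snd ℝ ℝ V) := by
  ext w
  refine (jetForm_apply L E (Fin.cons (1, 0) w)).trans ?_
  rw [L.map_coord_zero 0 (by simp), Fin.sum_univ_succ, Finset.sum_eq_zero fun j _ => ?_]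
  · simp
  · cases k with
    | zero => exact j.elim0
    | succ k => rw [E.map_coord_zero 0 (by simp), mul_zero, mul_zero]

theorem curryLeft_inr_compLinearMap_inr (D : (ℝ × V) [⋀^Fin (k + 1)]→ₗ[ℝ] ℝ) (α : V) :
    (D.curryLeft (0, α)).compLinearMap (LinearMap.inr ℝ ℝ V) =
      (D.compLinearMap (LinearMap.inr ℝ ℝ V)).curryLeft α :=
  (AlternatingMap.curryLeft_compLinearMap (LinearMap.inr ℝ ℝ V) D α).symm

theorem compLinearMap_snd_compLinearMap_inr (P : V [⋀^Fin k]→ₗ[ℝ] ℝ) :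
    (P.compLinearMap (LinearMap.snd ℝ ℝ V)).compLinearMap (LinearMap.inr ℝ ℝ V) = P := by
  rw [AlternatingMap.compLinearMap_assoc, LinearMap.snd_comp_inr, AlternatingMap.compLinearMap_id]

variable {ι : Type*} [Fintype ι] (L : V [⋀^Fin (m + 1 + 1)]→L[ℝ] ℝ) (E : V [⋀^Fin (m + 1)]→L[ℝ] ℝ)
  (L' : ι → V [⋀^Fin (m + 1 + 1)]→L[ℝ] ℝ) (E' : ι → V [⋀^Fin (m + 1)]→L[ℝ] ℝ) (dx : ι → V)

theorem jacobiator_jetForm_compLinearMap_inr :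
    (jacobiator (jetForm V (m + 1) (L, E)).toAlternatingMap
        (fun ν => (jetForm V (m + 1) (L' ν, E' ν)).toAlternatingMap) (1, 0)
        fun ν => (0, dx ν)).compLinearMap (LinearMap.inr ℝ ℝ V) =
      ((m + 1 : ℕ) : ℝ) • wedge E.toAlternatingMap L.toAlternatingMap -
        ∑ ν, wedge (L.toAlternatingMap.curryLeft (dx ν)) (L' ν).toAlternatingMap := by
  rw [compLinearMap_jacobiator]
  simp only [curryLeft_jetForm_one, curryLeft_inr_compLinearMap_inr, jetForm_compLinearMap_inr,
    compLinearMap_snd_compLinearMap_inr]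

theorem curryLeft_jacobiator_jetForm_compLinearMap_inr (hm : Odd (m + 1)) :
    (AlternatingMap.curryLeft (n := m + 1 + (m + 1))
      (jacobiator (jetForm V (m + 1) (L, E)).toAlternatingMap
        (fun ν => (jetForm V (m + 1) (L' ν, E' ν)).toAlternatingMap) (1, 0)
        fun ν => (0, dx ν)) (1, 0)).compLinearMap (LinearMap.inr ℝ ℝ V) =
      ∑ ν, ((wedge (E.toAlternatingMap.curryLeft (dx ν)) (L' ν).toAlternatingMap).domDomCongr
          (finCongr (by omega)) +
        wedge (L.toAlternatingMap.curryLeft (dx ν)) (E' ν).toAlternatingMap) := by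
  have domDomCongr_compLinearMap {a b : ℕ} (h : a = b) (P : (ℝ × V) [⋀^Fin a]→ₗ[ℝ] ℝ) :
      (P.domDomCongr (finCongr h)).compLinearMap (LinearMap.inr ℝ ℝ V) =
        (P.compLinearMap (LinearMap.inr ℝ ℝ V)).domDomCongr (finCongr h) := rfl
  rw [curryLeft_jacobiator_self hm]
  simp only [sum_compLinearMap, AlternatingMap.add_compLinearMap, domDomCongr_compLinearMap,
    wedge_compLinearMap, curryLeft_jetForm_one, curryLeft_inr_compLinearMap_inr,
    jetForm_compLinearMap_inr, compLinearMap_snd_compLinearMap_inr]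

theorem jacobiator_jetForm_eq_zero_iff (hm : Odd (m + 1)) :
    jacobiator (jetForm V (m + 1) (L, E)).toAlternatingMap
        (fun ν => (jetForm V (m + 1) (L' ν, E' ν)).toAlternatingMap) (1, 0)
        (fun ν => (0, dx ν)) = 0 ↔
      ∑ ν, wedge (L.toAlternatingMap.curryLeft (dx ν)) (L' ν).toAlternatingMap =
          ((m + 1 : ℕ) : ℝ) • wedge E.toAlternatingMap L.toAlternatingMap ∧
        ∑ ν, ((wedge (E.toAlternatingMap.curryLeft (dx ν)) (L' ν).toAlternatingMap).domDomCongr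
            (finCongr (by omega)) +
          wedge (L.toAlternatingMap.curryLeft (dx ν)) (E' ν).toAlternatingMap) = 0 := by
  refine (eq_zero_iff_inr_and_curryLeft_inr _).trans (and_congr ?_ ?_)
  · refine (Eq.congr_left (jacobiator_jetForm_compLinearMap_inr L E L' E' dx)).trans ?_
    rw [sub_eq_zero, eq_comm]
  · exact Eq.congr_left (curryLeft_jacobiator_jetForm_compLinearMap_inr L E L' E' dx hm)

end JetForm

section CoordinateSchouten

variable {n a m : ℕ}

theorem coordSchouten_self (ha : Odd a) (P : CoordSpace n → CoordDual n [⋀^Fin (a + 1)]→L[ℝ] ℝ)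
    (y : CoordSpace n) :
    coordSchouten P P y = (2 : ℝ) • ∑ ν, wedge (contract P ν y) (partialDeriv P ν y) := by
  rw [Finset.smul_sum]
  refine Finset.sum_congr rfl fun ν _ => ?_
  have swap := wedge_comm (partialDeriv P ν y) (contract P ν y)
  rw [mul_comm, (Nat.even_mul_succ_self a).neg_one_pow, one_smul] at swap
  rw [ha.add_one.neg_one_pow, one_smul, two_smul, ← swap]
  rfl

theorem domDomCongr_coordSchouten (hm : Odd (m + 1))
    (Q : CoordSpace n → CoordDual n [⋀^Fin (m + 1)]→L[ℝ] ℝ)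
    (P : CoordSpace n → CoordDual n [⋀^Fin (m + 1 + 1)]→L[ℝ] ℝ) (y : CoordSpace n) :
    (coordSchouten Q P y).domDomCongr (finCongr (by omega)) =
      ∑ ν, ((wedge (contract Q ν y) (partialDeriv P ν y)).domDomCongr (finCongr (by omega)) +
        wedge (contract P ν y) (partialDeriv Q ν y)) := by
  refine (map_sum (AlternatingMap.domDomCongrEquiv (finCongr _)) _ _).trans
    (Finset.sum_congr rfl fun ν _ => ?_)
  have swap := wedge_comm (partialDeriv Q ν y) (contract P ν y)
  rw [(hm.mul hm).neg_one_pow] at swap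
  rw [map_add, hm.neg_one_pow]
  refine congrArg (_ + ·) ?_
  ext v
  have swap_apply : wedge (partialDeriv Q ν y) (contract P ν y) v =
      -1 * wedge (contract P ν y) (partialDeriv Q ν y) v := DFunLike.congr_fun swap v
  exact (congrArg (-1 * ·) swap_apply).trans (by ring)

/-- The `jacobiator` at `y` of the fields of jet forms on `ℝⁿ` with components `P` and `Q`. -/
noncomputable def coordJacobiator {k : ℕ} (P : CoordSpace n → CoordDual n [⋀^Fin (k + 1)]→L[ℝ] ℝ)
    (Q : CoordSpace n → CoordDual n [⋀^Fin k]→L[ℝ] ℝ) (y : CoordSpace n) :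
    (ℝ × CoordDual n) [⋀^Fin (k + (k + 1))]→ₗ[ℝ] ℝ :=
  jacobiator (jetForm (CoordDual n) k (P y, Q y)).toAlternatingMap
    (fun ν => (jetForm (CoordDual n) k (fderiv ℝ P y (coordVector ν),
      fderiv ℝ Q y (coordVector ν))).toAlternatingMap) (1, 0) fun ν => (0, coordCovector ν)

theorem coordJacobiator_eq_zero_iff (hm : Odd (m + 1))
    (P : CoordSpace n → CoordDual n [⋀^Fin (m + 1 + 1)]→L[ℝ] ℝ)
    (Q : CoordSpace n → CoordDual n [⋀^Fin (m + 1)]→L[ℝ] ℝ) (y : CoordSpace n) :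
    coordJacobiator P Q y = 0 ↔
      coordSchouten P P y =
          (2 * ((m + 1 : ℕ) : ℝ)) • wedge (Q y).toAlternatingMap (P y).toAlternatingMap ∧
        coordSchouten Q P y = 0 := by
  refine (jacobiator_jetForm_eq_zero_iff _ _ _ _ _ hm).trans (and_congr ?_ ?_)
  · rw [coordSchouten_self hm, mul_smul]
    exact (smul_right_injective _ (two_ne_zero (α := ℝ))).eq_iff.symm
  · rw [← AlternatingMap.domDomCongr_eq_zero_iff _ (coordSchouten Q P y),
      domDomCongr_coordSchouten hm Q P y]
    rfl

end CoordinateSchouten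

section CoordinateJets

open Equiv Fin
open scoped Nat

variable {n k : ℕ}

/-- The `1`-jet `(F(y), dF(y))` of a function on `ℝⁿ`. -/
noncomputable def coordJet (F : CoordSpace n → ℝ) (y : CoordSpace n) : ℝ × CoordDual n :=
  (F y, fderiv ℝ F y)

/-- The bracket of functions on `ℝⁿ` attached to the components `P` and `Q` of a `(k+1)`- and a
`k`-vector field. -/
noncomputable def coordBracket (P : CoordSpace n → CoordDual n [⋀^Fin (k + 1)]→L[ℝ] ℝ)
    (Q : CoordSpace n → CoordDual n [⋀^Fin k]→L[ℝ] ℝ) (F : Fin (k + 1) → CoordSpace n → ℝ)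
    (y : CoordSpace n) : ℝ :=
  jetForm (CoordDual n) k (P y, Q y) fun i => coordJet (F i) y

theorem coordDual_eq_sum (α : CoordDual n) : α = ∑ ν, α (coordVector ν) • coordCovector ν := by
  ext x
  conv_lhs => rw [← (EuclideanSpace.basisFun (Fin n) ℝ).sum_repr x, map_sum]
  simp [coordVector, coordCovector, mul_comm]

theorem jet_eq_sum (a : ℝ) (α : CoordDual n) :
    (a, α) = a • ((1, 0) : ℝ × CoordDual n) +
      ∑ ν, α (coordVector ν) • ((0, coordCovector ν) : ℝ × CoordDual n) := by
  refine Prod.ext (by simp [Prod.fst_sum]) ?_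
  simpa [Prod.snd_sum] using coordDual_eq_sum α

theorem jet_contact_symm {H : CoordSpace n →L[ℝ] CoordDual n} (hH : ∀ u w, H u w = H w u)
    (a : ℝ) (γ : CoordDual n) (α β : Module.Dual ℝ (ℝ × CoordDual n)) :
    ∑ ν, α (0, coordCovector ν) * β (γ (coordVector ν), H (coordVector ν)) - α (a, γ) * β (1, 0) =
      ∑ ν, β (0, coordCovector ν) * α (γ (coordVector ν), H (coordVector ν)) -
        β (a, γ) * α (1, 0) := by
  have expand (α β : Module.Dual ℝ (ℝ × CoordDual n)) :
      ∑ ν, α (0, coordCovector ν) * β (γ (coordVector ν), H (coordVector ν)) -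
          α (a, γ) * β (1, 0) =
        ∑ ν, ∑ μ, H (coordVector ν) (coordVector μ) *
          (α (0, coordCovector ν) * β (0, coordCovector μ)) - a * (α (1, 0) * β (1, 0)) := by
    rw [jet_eq_sum a γ]
    simp only [jet_eq_sum (γ _), map_add, map_sum, map_smul, smul_eq_mul, mul_add, add_mul,
      Finset.sum_mul, Finset.mul_sum, Finset.sum_add_distrib]
    simp only [mul_left_comm, mul_comm]
    ring
  rw [expand, expand, Finset.sum_comm]
  refine congrArg₂ (· - ·) (Finset.sum_congr rfl fun ν _ => Finset.sum_congr rfl fun μ _ => ?_) ?_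
  · rw [hH, mul_comm (α _)]
  · rw [mul_comm (α _)]

theorem fderiv_jetForm_apply {X V : Type*} [NormedAddCommGroup X] [NormedSpace ℝ X]
    [NormedAddCommGroup V] [NormedSpace ℝ V] {P : X → V [⋀^Fin (k + 1)]→L[ℝ] ℝ}
    {Q : X → V [⋀^Fin k]→L[ℝ] ℝ} {j : Fin (k + 1) → X → ℝ × V} {j' : Fin (k + 1) → X →L[ℝ] ℝ × V}
    {y : X} (hP : DifferentiableAt ℝ P y) (hQ : DifferentiableAt ℝ Q y)
    (hj : ∀ i, HasFDerivAt (j i) (j' i) y) (u : X) :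
    fderiv ℝ (fun y => jetForm V k (P y, Q y) (fun i => j i y)) y u =
      jetForm V k (fderiv ℝ P y u, fderiv ℝ Q y u) (fun i => j i y) +
      ∑ i, jetForm V k (P y, Q y) (Function.update (fun i => j i y) i (j' i u)) := by
  let toMultilinear := (ContinuousAlternatingMap.toContinuousMultilinearMapCLM ℝ).comp (jetForm V k)
  have h := (toMultilinear.hasFDerivAt.comp y
    (hP.hasFDerivAt.prodMk hQ.hasFDerivAt)).continuousMultilinearMap_apply hj
  refine (DFunLike.congr_fun h.fderiv u).trans ?_
  simp [toMultilinear]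

theorem hasFDerivAt_coordJet {F : CoordSpace n → ℝ} {y : CoordSpace n} (hF : ContDiffAt ℝ ∞ F y) :
    HasFDerivAt (coordJet F) ((fderiv ℝ F y).prod (fderiv ℝ (fderiv ℝ F) y)) y :=
  (hF.differentiableAt (by simp)).hasFDerivAt.prodMk
    ((hF.fderiv_right (m := ∞) (by simp)).differentiableAt (by simp)).hasFDerivAt

theorem fderiv_coordBracket {P : CoordSpace n → CoordDual n [⋀^Fin (k + 1)]→L[ℝ] ℝ}
    {Q : CoordSpace n → CoordDual n [⋀^Fin k]→L[ℝ] ℝ} {F : Fin (k + 1) → CoordSpace n → ℝ}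
    {y : CoordSpace n} (hP : DifferentiableAt ℝ P y) (hQ : DifferentiableAt ℝ Q y)
    (hF : ∀ i, ContDiffAt ℝ ∞ (F i) y) (u : CoordSpace n) :
    fderiv ℝ (coordBracket P Q F) y u =
      jetForm (CoordDual n) k (fderiv ℝ P y u, fderiv ℝ Q y u) (fun i => coordJet (F i) y) +
      ∑ i, jetForm (CoordDual n) k (P y, Q y) (Function.update (fun i => coordJet (F i) y) i
        (fderiv ℝ (F i) y u, fderiv ℝ (fderiv ℝ (F i)) y u)) :=
  fderiv_jetForm_apply hP hQ (fun i => hasFDerivAt_coordJet (hF i)) u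

theorem coordBracket_congr (P : CoordSpace n → CoordDual n [⋀^Fin (k + 1)]→L[ℝ] ℝ)
    (Q : CoordSpace n → CoordDual n [⋀^Fin k]→L[ℝ] ℝ) {F G : Fin (k + 1) → CoordSpace n → ℝ}
    {y : CoordSpace n} (h : ∀ i, F i =ᶠ[nhds y] G i) :
    coordBracket P Q F y = coordBracket P Q G y :=
  congrArg (jetForm (CoordDual n) k (P y, Q y))
    (funext fun i => Prod.ext (h i).eq_of_nhds (h i).fderiv_eq)

theorem sum_sign_smul_coordBracket (hk : Odd k)
    {P : CoordSpace n → CoordDual n [⋀^Fin (k + 1)]→L[ℝ] ℝ}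
    {Q : CoordSpace n → CoordDual n [⋀^Fin k]→L[ℝ] ℝ} {y : CoordSpace n}
    (hP : DifferentiableAt ℝ P y) (hQ : DifferentiableAt ℝ Q y)
    {F : Fin (k + (k + 1)) → CoordSpace n → ℝ} (hF : ∀ i, ContDiffAt ℝ ∞ (F i) y) :
    ∑ σ : Perm (Fin (k + (k + 1))), Perm.sign σ •
      coordBracket P Q (snoc (α := fun _ => CoordSpace n → ℝ) (F ∘ σ ∘ castAdd (k + 1))
        (coordBracket P Q (F ∘ σ ∘ natAdd k))) y =
    (k ! * (k + 1)!) • coordJacobiator P Q y fun i => coordJet (F i) y := by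
  have hessian_symm (i : Fin (k + (k + 1))) (u w : CoordSpace n) :
      fderiv ℝ (fderiv ℝ (F i)) y u w = fderiv ℝ (fderiv ℝ (F i)) y w u :=
    (hF i).isSymmSndFDerivAt (by simpa using (ENat.LEInfty.out : (2 : WithTop ℕ∞) ≤ ∞)) u w
  refine .trans (Finset.sum_congr rfl fun σ _ => congrArg _ ?_)
    (sum_sign_smul_iterate hk _ _ _ _ (fun i => coordJet (F i) y)
      (fun ν i => (fderiv ℝ (F i) y (coordVector ν), fderiv ℝ (fderiv ℝ (F i)) y (coordVector ν)))
      fun i => jet_contact_symm (hessian_symm i) (F i y) (fderiv ℝ (F i) y))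
  have jet_snoc (G : CoordSpace n → ℝ) :
      (fun i => coordJet (snoc (α := fun _ => CoordSpace n → ℝ) (F ∘ σ ∘ castAdd (k + 1)) G i) y) =
      snoc (α := fun _ => ℝ × CoordDual n)
        ((fun i => coordJet (F i) y) ∘ σ ∘ castAdd (k + 1)) (coordJet G y) :=
    comp_snoc (coordJet · y) (F ∘ σ ∘ castAdd (k + 1)) G
  refine (congrArg (jetForm (CoordDual n) k (P y, Q y)) (jet_snoc _)).trans ?_
  refine congrArg (fun w => jetForm (CoordDual n) k (P y, Q y) (snoc _ w))
    ((jet_eq_sum _ _).trans ?_)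
  simp only [fderiv_coordBracket (F := F ∘ σ ∘ natAdd k) hP hQ fun _ => hF _]
  rfl

end CoordinateJets

section Charts

open Equiv Fin
open scoped Nat

variable {n k : ℕ} {M : Type*} [TopologicalSpace M] [ChartedSpace (EuclideanSpace ℝ (Fin n)) M]

theorem MultivectorField.differentiableAt_coordRep (P : MultivectorField n M k) (x : M) :
    DifferentiableAt ℝ (coordRep n P.toFun x) (extChartAt (𝓡 n) x x) :=
  ((P.smooth x).differentiableOn (by simp)).differentiableAt
    ((isOpen_extChartAt_target (I := 𝓡 n) x).mem_nhds (mem_extChartAt_target x))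

variable [IsManifold (𝓡 n) ∞ M]

theorem coordRep_apply_fderiv (P : MultivectorField n M k) {f : Fin k → M → ℝ}
    (hf : ∀ i, ContMDiff (𝓡 n) 𝓘(ℝ, ℝ) ∞ (f i)) (x₀ : M) {y : CoordSpace n}
    (hy : y ∈ (extChartAt (𝓡 n) x₀).target) :
    coordRep n P.toFun x₀ y (fun i => fderiv ℝ (f i ∘ (extChartAt (𝓡 n) x₀).symm) y) =
      P.toFun ((extChartAt (𝓡 n) x₀).symm y)
        fun i => differential (f i) ((extChartAt (𝓡 n) x₀).symm y) := by
  refine congrArg (P.toFun ((extChartAt (𝓡 n) x₀).symm y)) (funext fun i => ?_)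
  have h := chartPullback_differential (hf i) x₀ ((extChartAt (𝓡 n) x₀).map_target hy)
  rwa [(extChartAt (𝓡 n) x₀).right_inv hy] at h

theorem genJacobiBracket_extChartAt_symm (Λ : MultivectorField n M (k + 1))
    (E : MultivectorField n M k) (f : Fin (k + 1) → C^∞⟮𝓡 n, M; 𝓘(ℝ, ℝ), ℝ⟯) (x₀ : M)
    {y : CoordSpace n} (hy : y ∈ (extChartAt (𝓡 n) x₀).target) :
    genJacobiBracket Λ E f ((extChartAt (𝓡 n) x₀).symm y) =
      coordBracket (coordRep n Λ.toFun x₀) (coordRep n E.toFun x₀)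
        (fun i => f i ∘ (extChartAt (𝓡 n) x₀).symm) y := by
  refine .trans ?_ (jetForm_apply _ _ _).symm
  refine (sub_eq_add_neg _ _).trans (congrArg₂ (· + ·) ?_ ?_)
  · exact (coordRep_apply_fderiv Λ (fun i => (f i).contMDiff) x₀ hy).symm
  · rw [← Finset.sum_neg_distrib]
    refine Finset.sum_congr rfl fun j _ => ?_
    rw [← coordRep_apply_fderiv E (fun i => (f (j.succAbove i)).contMDiff) x₀ hy, pow_succ,
      mul_neg_one, neg_mul, neg_mul, neg_neg, mul_assoc]
    rfl

theorem genJacobiBracket_snoc_apply (Λ : MultivectorField n M (k + 1)) (E : MultivectorField n M k)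
    (f : Fin k → C^∞⟮𝓡 n, M; 𝓘(ℝ, ℝ), ℝ⟯) (g : Fin (k + 1) → C^∞⟮𝓡 n, M; 𝓘(ℝ, ℝ), ℝ⟯) (x : M) :
    genJacobiBracket Λ E (snoc (α := fun _ => C^∞⟮𝓡 n, M; 𝓘(ℝ, ℝ), ℝ⟯) f
        (genJacobiBracket Λ E g)) x =
      coordBracket (coordRep n Λ.toFun x) (coordRep n E.toFun x)
        (snoc (α := fun _ => CoordSpace n → ℝ) (fun i => f i ∘ (extChartAt (𝓡 n) x).symm)
          (coordBracket (coordRep n Λ.toFun x) (coordRep n E.toFun x)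
            fun i => g i ∘ (extChartAt (𝓡 n) x).symm)) (extChartAt (𝓡 n) x x) := by
  have hy := mem_extChartAt_target (I := 𝓡 n) x
  have at_center := genJacobiBracket_extChartAt_symm Λ E
    (snoc (α := fun _ => C^∞⟮𝓡 n, M; 𝓘(ℝ, ℝ), ℝ⟯) f (genJacobiBracket Λ E g)) x hy
  rw [extChartAt_to_inv] at at_center
  refine at_center.trans (coordBracket_congr _ _ fun i => ?_)
  cases i using lastCases with
  | last =>
    simp only [snoc_last]
    filter_upwards [(isOpen_extChartAt_target (I := 𝓡 n) x).mem_nhds hy] with y hy'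
    exact genJacobiBracket_extChartAt_symm Λ E g x hy'
  | cast i => simp only [snoc_castSucc, Filter.EventuallyEq.rfl]

theorem sum_sign_smul_genJacobiBracket_apply (hk : Odd k) (Λ : MultivectorField n M (k + 1))
    (E : MultivectorField n M k) (f : Fin (k + (k + 1)) → C^∞⟮𝓡 n, M; 𝓘(ℝ, ℝ), ℝ⟯) (x : M) :
    (∑ σ : Perm (Fin (k + (k + 1))), ((Perm.sign σ : ℤ) : ℝ) •
      genJacobiBracket Λ E (snoc (α := fun _ => C^∞⟮𝓡 n, M; 𝓘(ℝ, ℝ), ℝ⟯)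
        (fun i : Fin k => f (σ (castAdd (k + 1) i)))
        (genJacobiBracket Λ E fun i : Fin (k + 1) => f (σ (natAdd k i))))) x =
      (k ! * (k + 1)!) • coordJacobiator (coordRep n Λ.toFun x) (coordRep n E.toFun x)
        (extChartAt (𝓡 n) x x)
        fun i => coordJet (f i ∘ (extChartAt (𝓡 n) x).symm) (extChartAt (𝓡 n) x x) := by
  refine (map_sum (ContMDiffMap.evalRingHom x) _ _).trans (.trans ?_
    (sum_sign_smul_coordBracket hk (Λ.differentiableAt_coordRep x) (E.differentiableAt_coordRep x)
      fun i => (contDiffOn_comp_extChartAt_symm (f i).contMDiff x).contDiffAt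
        ((isOpen_extChartAt_target (I := 𝓡 n) x).mem_nhds (mem_extChartAt_target x))))
  refine Finset.sum_congr rfl fun σ _ => ?_
  rw [Units.smul_def, ← Int.cast_smul_eq_zsmul ℝ]
  exact congrArg (((Perm.sign σ : ℤ) : ℝ) • ·) (genJacobiBracket_snoc_apply Λ E _ _ x)

theorem exists_coordJet_eq [T2Space M] (x : M) (v : ℝ × CoordDual n) :
    ∃ f : C^∞⟮𝓡 n, M; 𝓘(ℝ, ℝ), ℝ⟯,
      coordJet (f ∘ (extChartAt (𝓡 n) x).symm) (extChartAt (𝓡 n) x x) = v := by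
  obtain ⟨ψ⟩ : Nonempty (SmoothBumpFunction (𝓡 n) x) := inferInstance
  set y₀ := extChartAt (𝓡 n) x x
  let affine (y : CoordSpace n) : ℝ := v.1 + v.2 (y - y₀)
  have contDiff_affine : ContDiff ℝ ∞ affine := by unfold affine; fun_prop
  have eventuallyEq : ((fun z => ψ z • affine (extChartAt (𝓡 n) x z)) ∘
      (extChartAt (𝓡 n) x).symm) =ᶠ[nhds y₀] affine := by
    have tendsto_symm : Filter.Tendsto (extChartAt (𝓡 n) x).symm (nhds y₀) (nhds x) := by
      simpa only [extChartAt_to_inv] using (continuousAt_extChartAt_symm (I := 𝓡 n) x).tendsto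
    filter_upwards [(isOpen_extChartAt_target (I := 𝓡 n) x).mem_nhds (mem_extChartAt_target x),
      tendsto_symm.eventually ψ.eventuallyEq_one] with y hy hψ
    simp only [Function.comp_apply, hψ, (extChartAt (𝓡 n) x).right_inv hy, Pi.one_apply, one_smul]
  have hasFDerivAt_affine : HasFDerivAt affine v.2 y₀ :=
    (v.2.hasFDerivAt.comp y₀ ((hasFDerivAt_id y₀).sub_const y₀)).const_add v.1
  refine ⟨⟨_, ψ.contMDiff_smul (contDiff_affine.contMDiff.comp_contMDiffOn
    contMDiffOn_extChartAt)⟩, Prod.ext ?_ ?_⟩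
  · exact eventuallyEq.eq_of_nhds.trans (by simp [affine])
  · exact eventuallyEq.fderiv_eq.trans hasFDerivAt_affine.fderiv

theorem genJacobiIdentity_iff [T2Space M] (hk : Odd k) (Λ : MultivectorField n M (k + 1))
    (E : MultivectorField n M k) :
    GenJacobiIdentity (genJacobiBracket Λ E) ↔ ∀ x, coordJacobiator (coordRep n Λ.toFun x)
      (coordRep n E.toFun x) (extChartAt (𝓡 n) x x) = 0 := by
  constructor
  · intro h x
    ext v
    choose f hf using fun i => exists_coordJet_eq x (v i)
    have h_sum := sum_sign_smul_genJacobiBracket_apply hk Λ E f x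
    rw [h f] at h_sum
    simp only [hf] at h_sum
    exact (smul_eq_zero.1 h_sum.symm).resolve_left
      (mul_ne_zero k.factorial_ne_zero (k + 1).factorial_ne_zero)
  · intro h f
    ext x
    refine (sum_sign_smul_genJacobiBracket_apply hk Λ E f x).trans ?_
    rw [h x, AlternatingMap.zero_apply, smul_zero]
    rfl

theorem chartPullback_chartPushforward (x : M) (α : Cotangent n x) :
    chartPullback n x x (chartPushforward n x α) = α := by
  have h := mfderivWithin_extChartAt_symm_comp_mfderiv_extChartAt' (I := 𝓡 n)
    (mem_extChartAt_source (I := 𝓡 n) x)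
  rw [ModelWithCorners.range_eq_univ, mfderivWithin_univ] at h
  exact ContinuousLinearMap.ext fun u => congrArg α (DFunLike.congr_fun h u)

theorem chartPushforward_surjective (x : M) : Function.Surjective (chartPushforward n x) := by
  have h := mfderiv_extChartAt_comp_mfderivWithin_extChartAt_symm' (I := 𝓡 n)
    (mem_extChartAt_source (I := 𝓡 n) x)
  rw [ModelWithCorners.range_eq_univ, mfderivWithin_univ] at h
  exact fun γ => ⟨chartPullback n x x γ,
    ContinuousLinearMap.ext fun u => congrArg γ (DFunLike.congr_fun h u)⟩

theorem coordRep_compLinearMap_chartPushforward (P : ∀ x : M, Cotangent n x [⋀^Fin k]→L[ℝ] ℝ)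
    (x : M) :
    (coordRep n P x (extChartAt (𝓡 n) x x)).toAlternatingMap.compLinearMap
      (chartPushforward n x).toLinearMap = (P x).toAlternatingMap := by
  ext α
  have pullback_pushforward (w : M) (hw : w = x) :
      P w (fun i => chartPullback n x w (chartPushforward n x (α i))) = P x α := by
    subst hw
    exact congrArg (P w) (funext fun i => chartPullback_chartPushforward w (α i))
  exact pullback_pushforward _ (extChartAt_to_inv x)

theorem MultivectorField.wedge_eq_compLinearMap {a b : ℕ} (P : MultivectorField n M a)
    (Q : MultivectorField n M b) (x : M) :
    P.wedge Q x = (_root_.wedge (coordRep n P.toFun x (extChartAt (𝓡 n) x x)).toAlternatingMap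
      (coordRep n Q.toFun x (extChartAt (𝓡 n) x x)).toAlternatingMap).compLinearMap
        (chartPushforward n x).toLinearMap := by
  rw [wedge_compLinearMap, coordRep_compLinearMap_chartPushforward,
    coordRep_compLinearMap_chartPushforward]
  rfl

theorem coordJacobiator_coordRep_eq_zero_iff {m : ℕ} (hm : Odd (m + 1))
    (Λ : MultivectorField n M (m + 2)) (E : MultivectorField n M (m + 1)) (x : M) :
    coordJacobiator (coordRep n Λ.toFun x) (coordRep n E.toFun x) (extChartAt (𝓡 n) x x) = 0 ↔
      Λ.schouten Λ x = (2 * ((m + 1 : ℕ) : ℝ)) • E.wedge Λ x ∧ E.schouten Λ x = 0 := by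
  rw [coordJacobiator_eq_zero_iff hm, MultivectorField.wedge_eq_compLinearMap]
  exact (and_congr (compLinearMap_eq_smul_iff (chartPushforward_surjective x) ..)
    (AlternatingMap.compLinearMap_inj _ (chartPushforward_surjective x) _ 0)).symm

end Charts

theorem lemma3p1 {n : ℕ} {M : Type*} [TopologicalSpace M] [T2Space M]
    [ChartedSpace (EuclideanSpace ℝ (Fin n)) M] [IsManifold (𝓡 n) ∞ M]
    (p m : ℕ) (hp : 2 * p = m + 2)
    (Λ : MultivectorField n M (m + 2)) (E : MultivectorField n M (m + 1)) :
    GenJacobiIdentity (genJacobiBracket Λ E) ↔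
      (∀ x : M, Λ.schouten Λ x = (2 * (2 * (p : ℝ) - 1)) • E.wedge Λ x) ∧
        (∀ x : M, E.schouten Λ x = 0) := by
  have odd_order : Odd (m + 1) := ⟨p - 1, by omega⟩
  have coefficient : 2 * (2 * (p : ℝ) - 1) = 2 * ((m + 1 : ℕ) : ℝ) := by
    have : (2 : ℝ) * p = m + 2 := mod_cast hp
    push_cast
    linarith
  rw [coefficient, ← forall_and]
  exact (genJacobiIdentity_iff odd_order Λ E).trans
    (forall_congr' fun x => coordJacobiator_coordRep_eq_zero_iff odd_order Λ E x)
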